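/- Let $\Theta\subset\mathbb{R}^m$ be compact, let $\mathcal{G}:\Theta\to\mathbb{R}^n$ be Borel measurable, and let $\rho_y$ be a probability measure on $\mathbb{R}^n$ that is absolutely continuous with respect to Lebesgue measure; its (finite, measurable) density is also written $\rho_y$. Let $\rho_x^*$ be a minimizer, with finite minimum value, of the entropy $$\mathcal{E}[\rho_x]=\int_\Theta \rho_x\ln\rho_x\,\mathrm{d}x\in(-\infty,+\infty]$$ over all probability densities $\rho_x$ on $\Theta$ (with respect to Lebesgue measure) such that $\mathcal{G}_\#\rho_x=\rho_y$. (i) The conditional distribution of $\rho_x^*$ on the level sets of $\mathcal{G}$ is uniform: $$\rho_x^*(\,\cdot\,|\,\mathcal{G}^{-1}(y))=\mathcal{U}(\mathcal{G}^{-1}(y))\qquad\text{for }\rho_y\text{-a.e. } y .$$ Here the conditional distributions of a probability measure $P$ on $\Theta$ are its disintegration with respect to $\mathcal{G}$, that is, a measurable family of probability measures $P(\cdot|\mathcal{G}^{-1}(y))$, $y\in\mathbb{R}^n$, concentrated on $\mathcal{G}^{-1}(y)$ for $\mathcal{G}_\#P$-a.e. $y$, with $P(B)=\int P(B|\mathcal{G}^{-1}(y))\,\mathrm{d}(\mathcal{G}_\#P)(y)$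 for all Borel sets $B\subseteq\Theta$; and the uniform distribution $\mathcal{U}(\mathcal{G}^{-1}(y))$ on a level set is the conditional distribution on $\mathcal{G}^{-1}(y)$ of the uniform distribution (normalized Lebesgue measure) on $\Theta$. Both disintegrations exist, and the equality holds for any choice of their versions. (ii) For Lebesgue-a.e. $x\in\Theta$, $$\rho_x^*(x)=\frac{\rho_y(\mathcal{G}(x))}{\int_\Theta\delta(\mathcal{G}(x)-\mathcal{G}(x'))\,\mathrm{d}x'} ,$$ where $$\int_\Theta\delta(y-\mathcal{G}(x'))\,\mathrm{d}x':=\lim_{\varepsilon\downarrow0}\frac{|\{x'\in\Theta:|y-\mathcal{G}(x')|\le\varepsilon\}|}{|\{z\in\mathbb{R}^n:|z|\le\varepsilon\}|} ;$$ this limit exists in $(0,+\infty]$ at $y=\mathcal{G}(x)$ for a.e. $x\in\Theta$, and the quotient is $0$ where it is $+\infty$. The formula also holds for a.e. $x\in\Theta$, with denominator in $(0,\infty)$, if $y\mapsto\int_\Theta\delta(y-\mathcal{G}(x'))\,\mathrm{d}x'$ is read in the sense of distributions, as any function $D$ that is a density with respect to Lebesgue measure of the push-forward under $\mathcal{G}$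 of Lebesgue measure on $\Theta$ (whenever this push-forward has a density). -/

import Mathlib

open MeasureTheory ProbabilityTheory Filter Topology
open scoped ENNReal NNReal

noncomputable section

namespace EntropyInversion

/-- Lebesgue measure on the subset `Θ` of `ℝᵐ`, as a measure on the subtype `Θ`. -/
def lebesgueOn {m : ℕ} (Θ : Set (EuclideanSpace ℝ (Fin m))) : Measure Θ :=
  Measure.comap Subtype.val (volume : Measure (EuclideanSpace ℝ (Fin m)))

/-- The probability density `ρ` on `Θ` (with respect to Lebesgue measure) defines this measure. -/
def densityMeasure {m : ℕ} {Θ : Set (EuclideanSpace ℝ (Fin m))} (ρ : Θ → ℝ≥0) : Measure Θ :=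
  (lebesgueOn Θ).withDensity (fun x => (ρ x : ℝ≥0∞))

/-- `ρ` is a feasible density: it is a probability density on `Θ` with respect to Lebesgue measure,
and the push-forward under `G` of the measure that it defines is `ρy`. -/
structure IsFeasible {m n : ℕ} {Θ : Set (EuclideanSpace ℝ (Fin m))}
    (G : Θ → EuclideanSpace ℝ (Fin n)) (ρy : Measure (EuclideanSpace ℝ (Fin n)))
    (ρ : Θ → ℝ≥0) : Prop where
  measurable : Measurable ρ
  mass_one : ∫⁻ x, (ρ x : ℝ≥0∞) ∂(lebesgueOn Θ) = 1
  pushforward : (densityMeasure ρ).map G = ρy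

/-- The entropy `∫_Θ ρ ln ρ dx` as an extended real number, namely the integral of the positive
part minus the integral of the negative part. On a set of finite Lebesgue measure the second
integral is finite because `t ln t ≥ -1/e`, so that the difference is meaningful there and has
a value in `(-∞, +∞]`. -/
def entropy {m : ℕ} {Θ : Set (EuclideanSpace ℝ (Fin m))} (ρ : Θ → ℝ≥0) : EReal :=
  ((∫⁻ x, ENNReal.ofReal ((ρ x : ℝ) * Real.log (ρ x)) ∂(lebesgueOn Θ) : ℝ≥0∞) : EReal) -
    ((∫⁻ x, ENNReal.ofReal (-((ρ x : ℝ) * Real.log (ρ x))) ∂(lebesgueOn Θ) : ℝ≥0∞) : EReal)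

/-- `ρ` solves the problem of minimizing the entropy over all feasible densities. The minimum value
is required to be finite, since otherwise every feasible density would be a minimizer. -/
structure IsEntropyMinimizer {m n : ℕ} {Θ : Set (EuclideanSpace ℝ (Fin m))}
    (G : Θ → EuclideanSpace ℝ (Fin n)) (ρy : Measure (EuclideanSpace ℝ (Fin n)))
    (ρ : Θ → ℝ≥0) : Prop where
  feasible : IsFeasible G ρy ρ
  finite : entropy ρ < ⊤
  minimal : ∀ ρ' : Θ → ℝ≥0, IsFeasible G ρy ρ' → entropy ρ ≤ entropy ρ'

/-- The family `y ↦ κ y` of probability measures is a version of the conditional distributions of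
`P` on the level sets `G⁻¹(y)`, that is, a disintegration of `P` with respect to `G`. -/
structure IsConditional {X Y : Type*} [MeasurableSpace X] [MeasurableSpace Y]
    (G : X → Y) (P : Measure X) (κ : Kernel Y X) : Prop where
  probability : ∀ y, IsProbabilityMeasure (κ y)
  concentrated : ∀ᵐ y ∂(P.map G), κ y (G ⁻¹' {y})ᶜ = 0
  disintegrates : ∀ B : Set X, MeasurableSet B → P B = ∫⁻ y, κ y B ∂(P.map G)

/-- The uniform distribution on `Θ`: normalized Lebesgue measure. -/
def uniformDistribution {m : ℕ} (Θ : Set (EuclideanSpace ℝ (Fin m))) : Measure Θ :=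
  (lebesgueOn Θ Set.univ)⁻¹ • lebesgueOn Θ

/-- The family `y ↦ u y` is a version of the uniform distributions on the level sets `G⁻¹(y)`.
Level sets may be Lebesgue null sets, so "uniform" refers to the measure that Lebesgue measure
on `Θ` induces on them: `u y` is the conditional distribution on `G⁻¹(y)` of the uniform
distribution on `Θ`. (If `G⁻¹(y)` has positive Lebesgue measure, this is normalized Lebesgue measure
on it.) -/
def IsUniformOnLevelSets {m n : ℕ} {Θ : Set (EuclideanSpace ℝ (Fin m))}
    (G : Θ → EuclideanSpace ℝ (Fin n)) (u : Kernel (EuclideanSpace ℝ (Fin n)) Θ) : Prop :=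
  IsConditional G (uniformDistribution Θ) u

/-- The function `D` is `y ↦ ∫_Θ δ(y - G(x')) dx'` in the sense of distributions: the density of the
push-forward of Lebesgue measure on `Θ` under `G`, so that
`∫ f(y) D(y) dy = ∫_Θ f(G(x')) dx'` for all test functions `f`. -/
def IsDeltaDensity {m n : ℕ} {Θ : Set (EuclideanSpace ℝ (Fin m))}
    (G : Θ → EuclideanSpace ℝ (Fin n)) (D : EuclideanSpace ℝ (Fin n) → ℝ≥0∞) : Prop :=
  Measurable D ∧ (lebesgueOn Θ).map G = volume.withDensity D

/-- The number `d ∈ [0, ∞]` is the value of `∫_Θ δ(y - G(x')) dx'` at the point `y`, where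
the Dirac delta is the limit, as `ε → 0`, of the indicator function of the ball of radius `ε` divided
by the volume of that ball. -/
def IsDeltaIntegralAt {m n : ℕ} {Θ : Set (EuclideanSpace ℝ (Fin m))}
    (G : Θ → EuclideanSpace ℝ (Fin n)) (y : EuclideanSpace ℝ (Fin n)) (d : ℝ≥0∞) : Prop :=
  Tendsto (fun ε : ℝ => lebesgueOn Θ {x' : Θ | ‖y - G x'‖ ≤ ε} /
    (volume : Measure (EuclideanSpace ℝ (Fin n))) (Metric.closedBall 0 ε)) (𝓝[>] 0) (𝓝 d)

end EntropyInversion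

end

/-! Let `ν` be the image of Lebesgue measure under `G`, and `g` the density of `ρy` with respect to
`ν`. Averaging a feasible `ρ` over the level sets gives `g ∘ G`, which is again feasible. The
tangent term of the Bregman divergence of `t log t` at `g ∘ G` is `log (g ∘ G) + 1` times `ρ - g ∘
G`. Its factor is a function of `G`, so it integrates to zero where `log g` is bounded, and
exhaustion by such sets gives a Pythagorean identity: the entropy of `ρ` is that of `g ∘ G` plus the
integrated divergence (`lintegral_bregman_add`). For a minimizer the divergence vanishes, so `ρ = g
∘ G` almost everywhere (`IsEntropyMinimizer.ae_eq_comp`).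

A density that depends only on `G` leaves conditional distributions unchanged, which gives (i). For
(ii), `g` is `r` times the derivative of Lebesgue measure with respect to `ν`, whose inverse is the
limit defining the delta integral. -/

namespace EntropyInversion

/-! ### Pointwise convexity of `t log t` -/

section Bregman

/-- The Bregman divergence of `t ↦ t log t`. -/
noncomputable def bregman (t s : ℝ) : ℝ :=
  t * Real.log t - s * Real.log s - (Real.log s + 1) * (t - s)

lemma bregman_eq_mul_klFun {t s : ℝ} (ht : 0 ≤ t) (hs : 0 < s) :
    bregman t s = s * InformationTheory.klFun (t / s) := by
  rw [bregman, InformationTheory.klFun_apply]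
  rcases ht.eq_or_lt with rfl | ht
  · simp
    ring
  · rw [Real.log_div ht.ne' hs.ne']
    field_simp
    ring

lemma bregman_nonneg {t s : ℝ} (ht : 0 ≤ t) (hs : 0 < s) : 0 ≤ bregman t s := by
  rw [bregman_eq_mul_klFun ht hs]
  exact mul_nonneg hs.le (InformationTheory.klFun_nonneg (by positivity))

lemma eq_of_bregman_nonpos {t s : ℝ} (ht : 0 ≤ t) (hs : 0 < s) (h : bregman t s ≤ 0) : t = s := by
  have h0 := le_antisymm h (bregman_nonneg ht hs)
  rw [bregman_eq_mul_klFun ht hs, mul_eq_zero, or_iff_right hs.ne',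
    InformationTheory.klFun_eq_zero_iff (by positivity), div_eq_one_iff_eq hs.ne'] at h0
  exact h0

lemma mul_log_add_one_nonneg {t : ℝ} (ht : 0 ≤ t) : 0 ≤ t * Real.log t + 1 := by
  linarith [Real.self_sub_one_le_mul_log ht]

/-- This is the definition of `bregman` rearranged without subtraction: the tangent slope is split
into positive and negative parts, and the shift by 1 makes `t log t` nonnegative. The case `s = 0`
needs `h`, since `Real.log 0 = 0` is not the true slope. -/
lemma ofReal_bregman_add {t s : ℝ≥0} (h : s = 0 → t = 0) :
    ENNReal.ofReal (bregman t s) + ENNReal.ofReal (s * Real.log s + 1) +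
        (t * ENNReal.ofReal (Real.log s + 1) + s * ENNReal.ofReal (-(Real.log s + 1))) =
      ENNReal.ofReal (t * Real.log t + 1) +
        (s * ENNReal.ofReal (Real.log s + 1) + t * ENNReal.ofReal (-(Real.log s + 1))) := by
  rcases eq_or_ne s 0 with rfl | hs
  · simp [h rfl, bregman]
  have hs' : (0 : ℝ) < s := by positivity
  have hb := bregman_nonneg t.2 hs'
  have hψs := mul_log_add_one_nonneg s.2
  have hψt := mul_log_add_one_nonneg t.2
  simp only [NNReal.val_eq_coe] at hb hψs hψt
  rw [← ENNReal.toReal_eq_toReal_iff' (by finiteness) (by finiteness)]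
  rw [ENNReal.toReal_add (by finiteness) (by finiteness),
    ENNReal.toReal_add (by finiteness) (by finiteness),
    ENNReal.toReal_add (by finiteness) (by finiteness),
    ENNReal.toReal_add (by finiteness) (by finiteness),
    ENNReal.toReal_add (by finiteness) (by finiteness)]
  simp only [ENNReal.toReal_mul, ENNReal.coe_toReal, ENNReal.toReal_ofReal hb,
    ENNReal.toReal_ofReal hψs, ENNReal.toReal_ofReal hψt, ENNReal.toReal_ofReal']
  have hq : max (Real.log s + 1) 0 - max (-(Real.log s + 1)) 0 = Real.log s + 1 := by
    rcases le_total 0 (Real.log s + 1) with h | h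
    · rw [max_eq_left h, max_eq_right (by linarith), sub_zero]
    · rw [max_eq_right h, max_eq_left (by linarith), zero_sub, neg_neg]
  rw [bregman]
  linear_combination ((t : ℝ) - s) * hq

end Bregman

/-! ### Pythagorean identity for averaging over level sets -/

section Jensen

variable {X Y : Type*} [MeasurableSpace X] [MeasurableSpace Y]

/-- If `g` is the density of the image of `f μ` with respect to the image of `μ`, then `f` and
`g ∘ G` have the same integrals against functions of `G`. -/
lemma lintegral_mul_comp_eq {μ : Measure X} {G : X → Y} (hG : Measurable G) {f : X → ℝ≥0}
    (hf : Measurable f) {g : Y → ℝ≥0} (hg : Measurable g)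
    (h : (μ.withDensity fun x ↦ (f x : ℝ≥0∞)).map G =
      (μ.map G).withDensity fun y ↦ (g y : ℝ≥0∞)) {k : Y → ℝ≥0∞} (hk : Measurable k) :
    ∫⁻ x, f x * k (G x) ∂μ = ∫⁻ x, g (G x) * k (G x) ∂μ := by
  calc ∫⁻ x, f x * k (G x) ∂μ
      = ∫⁻ y, k y ∂((μ.withDensity fun x ↦ (f x : ℝ≥0∞)).map G) := by
        rw [lintegral_map hk hG, lintegral_withDensity_eq_lintegral_mul _ (by fun_prop)
          (by fun_prop)]
        rfl
    _ = ∫⁻ x, g (G x) * k (G x) ∂μ := by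
        rw [h, lintegral_withDensity_eq_lintegral_mul _ (by fun_prop) (by fun_prop),
          lintegral_map (by fun_prop) hG]
        rfl

/-- Testing against the indicator of `{g = 0}` shows that `f` has no mass on its preimage. -/
lemma ae_eq_zero_of_comp_eq_zero {μ : Measure X} {G : X → Y} (hG : Measurable G) {f : X → ℝ≥0}
    (hf : Measurable f) {g : Y → ℝ≥0} (hg : Measurable g)
    (h : (μ.withDensity fun x ↦ (f x : ℝ≥0∞)).map G =
      (μ.map G).withDensity fun y ↦ (g y : ℝ≥0∞)) :
    ∀ᵐ x ∂μ, g (G x) = 0 → f x = 0 := by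
  have hs : MeasurableSet {y | g y = 0} := hg (measurableSet_singleton 0)
  have h1 := lintegral_mul_comp_eq hG hf hg h
    (k := {y | g y = 0}.indicator 1) (measurable_one.indicator hs)
  have h2 : ∀ x, (g (G x) : ℝ≥0∞) * {y | g y = 0}.indicator 1 (G x) = 0 := by
    intro x
    by_cases hx : g (G x) = 0 <;> simp [hx]
  simp only [h2, lintegral_zero] at h1
  rw [lintegral_eq_zero_iff (by
    exact hf.coe_nnreal_ennreal.mul ((measurable_one.indicator hs).comp hG))] at h1
  filter_upwards [h1] with x hx hgx
  simpa [hgx] using hx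

/-- The Pythagorean identity for entropies on a set where `log g` is bounded. -/
lemma setLIntegral_bregman_add {μ : Measure X} [IsFiniteMeasure μ] {G : X → Y}
    (hG : Measurable G) {f : X → ℝ≥0} (hf : Measurable f) (hfi : ∫⁻ x, f x ∂μ ≠ ∞)
    {g : Y → ℝ≥0} (hg : Measurable g)
    (h : (μ.withDensity fun x ↦ (f x : ℝ≥0∞)).map G =
      (μ.map G).withDensity fun y ↦ (g y : ℝ≥0∞)) {A : Set Y} (hA : MeasurableSet A) {c : ℝ}
    (hc : ∀ y ∈ A, |Real.log (g y) + 1| ≤ c) :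
    ∫⁻ x in G ⁻¹' A, (ENNReal.ofReal (bregman (f x) (g (G x))) +
        ENNReal.ofReal (g (G x) * Real.log (g (G x)) + 1)) ∂μ =
      ∫⁻ x in G ⁻¹' A, ENNReal.ofReal (f x * Real.log (f x) + 1) ∂μ := by
  have hswap : ∀ k : Y → ℝ≥0∞, Measurable k → ∫⁻ x in G ⁻¹' A, f x * k (G x) ∂μ =
      ∫⁻ x in G ⁻¹' A, g (G x) * k (G x) ∂μ := by
    intro k hk
    have h1 := lintegral_mul_comp_eq hG hf hg h (hk.indicator hA)
    rw [← lintegral_indicator (hG hA), ← lintegral_indicator (hG hA)]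
    convert h1 using 3 with x x <;> by_cases hx : G x ∈ A <;> simp [hx]
  -- Boundedness on `A` makes the tangent terms finite, so that they can be cancelled at the end.
  have hfin : ∀ k : Y → ℝ≥0∞, (∀ y ∈ A, k y ≤ ENNReal.ofReal c) →
      ∫⁻ x in G ⁻¹' A, f x * k (G x) ∂μ ≠ ∞ := by
    intro k hk
    refine ne_top_of_le_ne_top (ENNReal.mul_ne_top hfi (ENNReal.ofReal_ne_top (r := c))) ?_
    rw [← lintegral_mul_const _ (by fun_prop)]
    refine (setLIntegral_mono (by fun_prop) fun x hx ↦ ?_).trans (setLIntegral_le_lintegral _ _)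
    gcongr
    exact hk _ hx
  set p : Y → ℝ≥0∞ := fun y ↦ ENNReal.ofReal (Real.log (g y) + 1)
  set q : Y → ℝ≥0∞ := fun y ↦ ENNReal.ofReal (-(Real.log (g y) + 1))
  have hpm : Measurable p := by fun_prop
  have hqm : Measurable q := by fun_prop
  have hpc := hfin p fun y hy ↦ ENNReal.ofReal_le_ofReal ((le_abs_self _).trans (hc y hy))
  have hqc := hfin q fun y hy ↦ ENNReal.ofReal_le_ofReal ((neg_le_abs _).trans (hc y hy))
  have hae : ∫⁻ x in G ⁻¹' A, (ENNReal.ofReal (bregman (f x) (g (G x))) +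
        ENNReal.ofReal (g (G x) * Real.log (g (G x)) + 1) +
          (f x * p (G x) + g (G x) * q (G x))) ∂μ =
      ∫⁻ x in G ⁻¹' A, (ENNReal.ofReal (f x * Real.log (f x) + 1) +
        (g (G x) * p (G x) + f x * q (G x))) ∂μ :=
    lintegral_congr_ae (ae_restrict_of_ae ((ae_eq_zero_of_comp_eq_zero hG hf hg h).mono
      fun x hx ↦ ofReal_bregman_add hx))
  have hsplit : ∫⁻ x in G ⁻¹' A, (f x * p (G x) + g (G x) * q (G x)) ∂μ =
      ∫⁻ x in G ⁻¹' A, (g (G x) * p (G x) + f x * q (G x)) ∂μ := by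
    rw [lintegral_add_left (by fun_prop), lintegral_add_left (by fun_prop), hswap p hpm,
      hswap q hqm]
  have hsum : ∫⁻ x in G ⁻¹' A, (g (G x) * p (G x) + f x * q (G x)) ∂μ ≠ ∞ := by
    rw [lintegral_add_left (by fun_prop), ← hswap p hpm]
    exact ENNReal.add_ne_top.2 ⟨hpc, hqc⟩
  have hm₁ : Measurable fun x ↦ f x * p (G x) + g (G x) * q (G x) := by fun_prop
  have hm₂ : Measurable fun x ↦ g (G x) * p (G x) + f x * q (G x) := by fun_prop
  rw [lintegral_add_right _ hm₁, lintegral_add_right _ hm₂, hsplit] at hae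
  exact (ENNReal.add_left_inj hsum).1 hae

/-- The Pythagorean identity for entropies. -/
lemma lintegral_bregman_add {μ : Measure X} [IsFiniteMeasure μ] {G : X → Y}
    (hG : Measurable G) {f : X → ℝ≥0} (hf : Measurable f) (hfi : ∫⁻ x, f x ∂μ ≠ ∞)
    {g : Y → ℝ≥0} (hg : Measurable g)
    (h : (μ.withDensity fun x ↦ (f x : ℝ≥0∞)).map G =
      (μ.map G).withDensity fun y ↦ (g y : ℝ≥0∞)) :
    ∫⁻ x, ENNReal.ofReal (bregman (f x) (g (G x))) ∂μ +
        ∫⁻ x, ENNReal.ofReal (g (G x) * Real.log (g (G x)) + 1) ∂μ =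
      ∫⁻ x, ENNReal.ofReal (f x * Real.log (f x) + 1) ∂μ := by
  rw [← lintegral_add_right _ (by fun_prop)]
  -- These sets exhaust `Y`, including `{g = 0}`, because `Real.log 0 = 0`.
  let A : ℕ → Set Y := fun k ↦ {y | |Real.log (g y) + 1| ≤ k}
  have hA : ∀ k, MeasurableSet (A k) := fun k ↦
    measurableSet_le (by fun_prop) measurable_const
  have hmono : Monotone fun k ↦ G ⁻¹' A k := fun i j hij x hx ↦
    (show |Real.log (g (G x)) + 1| ≤ i from hx).trans (Nat.cast_le.2 hij)
  have hU : ⋃ k, G ⁻¹' A k = Set.univ := Set.eq_univ_of_forall fun x ↦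
    Set.mem_iUnion.2 (exists_nat_ge |Real.log (g (G x)) + 1|)
  rw [← setLIntegral_univ, ← setLIntegral_univ (μ := μ), ← hU,
    setLIntegral_iUnion_of_directed _ hmono.directed_le,
    setLIntegral_iUnion_of_directed _ hmono.directed_le]
  exact iSup_congr fun k ↦ setLIntegral_bregman_add hG hf hfi hg h (hA k) fun y hy ↦ hy

/-- A density whose entropy is finite and at most that of its average over the level sets of `G`
is equal to this average. -/
lemma ae_eq_comp_of_lintegral_le {μ : Measure X} [IsFiniteMeasure μ] {G : X → Y}
    (hG : Measurable G) {f : X → ℝ≥0} (hf : Measurable f) (hfi : ∫⁻ x, f x ∂μ ≠ ∞)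
    {g : Y → ℝ≥0} (hg : Measurable g)
    (h : (μ.withDensity fun x ↦ (f x : ℝ≥0∞)).map G =
      (μ.map G).withDensity fun y ↦ (g y : ℝ≥0∞))
    (hfin : ∫⁻ x, ENNReal.ofReal (f x * Real.log (f x) + 1) ∂μ ≠ ∞)
    (hle : ∫⁻ x, ENNReal.ofReal (f x * Real.log (f x) + 1) ∂μ ≤
      ∫⁻ x, ENNReal.ofReal (g (G x) * Real.log (g (G x)) + 1) ∂μ) :
    ∀ᵐ x ∂μ, f x = g (G x) := by
  have hpyth := lintegral_bregman_add hG hf hfi hg h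
  have hB : ∫⁻ x, ENNReal.ofReal (bregman (f x) (g (G x))) ∂μ = 0 := by
    have hgfin : ∫⁻ x, ENNReal.ofReal (g (G x) * Real.log (g (G x)) + 1) ∂μ ≠ ∞ :=
      ne_top_of_le_ne_top hfin (hpyth ▸ le_add_self)
    rw [← hpyth] at hle
    by_contra h0
    rw [add_comm] at hle
    exact (ENNReal.lt_add_right hgfin h0).not_ge hle
  rw [lintegral_eq_zero_iff (by unfold bregman; fun_prop)] at hB
  filter_upwards [hB, ae_eq_zero_of_comp_eq_zero hG hf hg h] with x hx h0
  rcases eq_or_ne (g (G x)) 0 with hg0 | hg0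
  · rw [hg0, h0 hg0]
  · have hpos : (0 : ℝ) < g (G x) := by positivity
    exact NNReal.eq (eq_of_bregman_nonpos (f x).2 hpos (ENNReal.ofReal_eq_zero.1 hx))

end Jensen

/-! ### From the extended-real entropy to a nonnegative integral -/

section Entropy

variable {m : ℕ} {Θ : Set (EuclideanSpace ℝ (Fin m))}

lemma lintegral_mul_log_add_one_add [IsFiniteMeasure (lebesgueOn Θ)] {ρ : Θ → ℝ≥0}
    (hρ : Measurable ρ) :
    ∫⁻ x, ENNReal.ofReal (ρ x * Real.log (ρ x) + 1) ∂(lebesgueOn Θ) +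
        ∫⁻ x, ENNReal.ofReal (-(ρ x * Real.log (ρ x))) ∂(lebesgueOn Θ) =
      ∫⁻ x, ENNReal.ofReal (ρ x * Real.log (ρ x)) ∂(lebesgueOn Θ) +
        lebesgueOn Θ Set.univ := by
  rw [← lintegral_one, ← lintegral_add_right _ (by fun_prop),
    ← lintegral_add_right _ (by fun_prop)]
  refine lintegral_congr fun x ↦ ?_
  have h := mul_log_add_one_nonneg (ρ x).2
  simp only [NNReal.val_eq_coe] at h
  rcases le_total 0 ((ρ x : ℝ) * Real.log (ρ x)) with h0 | h0
  · rw [ENNReal.ofReal_of_nonpos (neg_nonpos.2 h0), add_zero,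
      ENNReal.ofReal_add h0 zero_le_one, ENNReal.ofReal_one]
  · rw [ENNReal.ofReal_of_nonpos h0, zero_add, ← ENNReal.ofReal_add h (by linarith)]
    simp

lemma lintegral_neg_mul_log_ne_top [IsFiniteMeasure (lebesgueOn Θ)] (ρ : Θ → ℝ≥0) :
    ∫⁻ x, ENNReal.ofReal (-(ρ x * Real.log (ρ x))) ∂(lebesgueOn Θ) ≠ ∞ := by
  refine ne_top_of_le_ne_top (measure_ne_top (lebesgueOn Θ) Set.univ) ?_
  rw [← lintegral_one]
  refine lintegral_mono fun x ↦ ENNReal.ofReal_le_one.2 ?_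
  have h := mul_log_add_one_nonneg (ρ x).2
  simp only [NNReal.val_eq_coe] at h
  linarith

lemma lintegral_mul_log_ne_top_of_entropy_lt_top [IsFiniteMeasure (lebesgueOn Θ)]
    {ρ : Θ → ℝ≥0} (h : entropy ρ < ⊤) :
    ∫⁻ x, ENNReal.ofReal (ρ x * Real.log (ρ x)) ∂(lebesgueOn Θ) ≠ ∞ := by
  intro htop
  rw [entropy, htop] at h
  lift ∫⁻ x, ENNReal.ofReal (-(ρ x * Real.log (ρ x))) ∂(lebesgueOn Θ) to ℝ≥0
    using lintegral_neg_mul_log_ne_top ρ with N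
  exact h.ne (EReal.top_sub_coe N)

lemma lintegral_mul_log_add_one_ne_top [IsFiniteMeasure (lebesgueOn Θ)] {ρ : Θ → ℝ≥0}
    (hρ : Measurable ρ) (h : entropy ρ < ⊤) :
    ∫⁻ x, ENNReal.ofReal (ρ x * Real.log (ρ x) + 1) ∂(lebesgueOn Θ) ≠ ∞ := by
  have h1 := lintegral_mul_log_add_one_add hρ
  refine ne_top_of_le_ne_top (ENNReal.add_ne_top.2
    ⟨lintegral_mul_log_ne_top_of_entropy_lt_top h, measure_ne_top _ _⟩) (h1 ▸ le_self_add)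

/-- The shifted integral is the entropy plus the finite volume of `Θ`, so entropy comparisons carry
over to it. -/
lemma lintegral_mul_log_add_one_le [IsFiniteMeasure (lebesgueOn Θ)] {ρ ρ' : Θ → ℝ≥0}
    (hρ : Measurable ρ) (hρ' : Measurable ρ') (hfin : entropy ρ < ⊤)
    (hle : entropy ρ ≤ entropy ρ') :
    ∫⁻ x, ENNReal.ofReal (ρ x * Real.log (ρ x) + 1) ∂(lebesgueOn Θ) ≤
      ∫⁻ x, ENNReal.ofReal (ρ' x * Real.log (ρ' x) + 1) ∂(lebesgueOn Θ) := by
  have h1 := lintegral_mul_log_add_one_add hρ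
  have h2 := lintegral_mul_log_add_one_add hρ'
  have hP := lintegral_mul_log_ne_top_of_entropy_lt_top hfin
  have hI := lintegral_mul_log_add_one_ne_top hρ hfin
  rcases eq_or_ne (∫⁻ x, ENNReal.ofReal (ρ' x * Real.log (ρ' x) + 1) ∂(lebesgueOn Θ)) ∞
    with hI' | hI'
  · rw [hI']
    exact le_top
  have hN := lintegral_neg_mul_log_ne_top ρ
  have hN' := lintegral_neg_mul_log_ne_top ρ'
  have hP' : ∫⁻ x, ENNReal.ofReal (ρ' x * Real.log (ρ' x)) ∂(lebesgueOn Θ) ≠ ∞ :=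
    ne_top_of_le_ne_top (ENNReal.add_ne_top.2 ⟨hI', hN'⟩) (h2 ▸ le_self_add)
  have hV : lebesgueOn Θ Set.univ ≠ ∞ := measure_ne_top _ _
  unfold entropy at hle
  generalize ∫⁻ x, ENNReal.ofReal (ρ' x * Real.log (ρ' x) + 1) ∂(lebesgueOn Θ) = I' at *
  generalize ∫⁻ x, ENNReal.ofReal (ρ x * Real.log (ρ x) + 1) ∂(lebesgueOn Θ) = I at *
  generalize ∫⁻ x, ENNReal.ofReal (ρ' x * Real.log (ρ' x)) ∂(lebesgueOn Θ) = P' at *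
  generalize ∫⁻ x, ENNReal.ofReal (ρ x * Real.log (ρ x)) ∂(lebesgueOn Θ) = P at *
  generalize ∫⁻ x, ENNReal.ofReal (-(ρ' x * Real.log (ρ' x))) ∂(lebesgueOn Θ) = N' at *
  generalize ∫⁻ x, ENNReal.ofReal (-(ρ x * Real.log (ρ x))) ∂(lebesgueOn Θ) = N at *
  generalize lebesgueOn Θ Set.univ = V at *
  lift I to ℝ≥0 using hI
  lift I' to ℝ≥0 using hI'
  lift P to ℝ≥0 using hP
  lift P' to ℝ≥0 using hP'
  lift N to ℝ≥0 using hN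
  lift N' to ℝ≥0 using hN'
  lift V to ℝ≥0 using hV
  have hle' : (P : ℝ) - N ≤ P' - N' := by
    rw [← EReal.coe_le_coe_iff, EReal.coe_sub, EReal.coe_sub]
    exact hle
  have h1' : (I : ℝ) + N = P + V := by exact_mod_cast h1
  have h2' : (I' : ℝ) + N' = P' + V := by exact_mod_cast h2
  have : (I : ℝ) ≤ I' := by linarith
  exact_mod_cast this

lemma isFiniteMeasure_lebesgueOn (hΘ : IsCompact Θ) : IsFiniteMeasure (lebesgueOn Θ) := by
  refine ⟨?_⟩
  rw [lebesgueOn, comap_subtype_coe_apply hΘ.measurableSet]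
  simpa using hΘ.measure_lt_top

/-- The minimizer is a function of `G`, namely the density of the data distribution with respect to
the image of Lebesgue measure. -/
lemma IsEntropyMinimizer.ae_eq_comp {n : ℕ} (hΘ : IsCompact Θ)
    {G : Θ → EuclideanSpace ℝ (Fin n)} (hG : Measurable G)
    {ρy : Measure (EuclideanSpace ℝ (Fin n))} {ρ : Θ → ℝ≥0} (hρ : IsEntropyMinimizer G ρy ρ)
    {g : EuclideanSpace ℝ (Fin n) → ℝ≥0} (hg : Measurable g)
    (h : ρy = ((lebesgueOn Θ).map G).withDensity fun y ↦ (g y : ℝ≥0∞)) :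
    ∀ᵐ x ∂(lebesgueOn Θ), ρ x = g (G x) := by
  have := isFiniteMeasure_lebesgueOn hΘ
  have hpush := hρ.feasible.pushforward.trans h
  -- The level-set average is the competitor against which minimality is used.
  have hfeas : IsFeasible G ρy fun x ↦ g (G x) := by
    refine ⟨hg.comp hG, ?_, ?_⟩
    · have h1 := lintegral_mul_comp_eq hG hρ.feasible.measurable hg hpush
        (k := fun _ ↦ 1) measurable_const
      simp only [mul_one] at h1
      rw [← h1, hρ.feasible.mass_one]
    · rw [h]
      ext s hs
      rw [densityMeasure, Measure.map_apply hG hs, withDensity_apply _ (hG hs),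
        withDensity_apply _ hs, setLIntegral_map hs (by fun_prop) hG]
  refine ae_eq_comp_of_lintegral_le hG hρ.feasible.measurable ?_ hg hpush
    (lintegral_mul_log_add_one_ne_top hρ.feasible.measurable hρ.finite)
    (lintegral_mul_log_add_one_le hρ.feasible.measurable hfeas.measurable hρ.finite
      (hρ.minimal _ hfeas))
  rw [hρ.feasible.mass_one]
  exact ENNReal.one_ne_top

end Entropy

/-! ### Existence, uniqueness and invariance of disintegrations -/

section Conditional

variable {X Y : Type*} [MeasurableSpace X] [MeasurableSpace Y]

lemma exists_isConditional [StandardBorelSpace X] [Nonempty X] [MeasurableEq Y] {G : X → Y} (hG : Measurable G)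
    (P : Measure X) [IsFiniteMeasure P] : ∃ κ : Kernel Y X, IsConditional G P κ := by
  have hc := compProd_map_condDistrib (X := G) (Y := (id : X → X)) (μ := P) (mβ := inferInstance)
    aemeasurable_id
  have hS : MeasurableSet {p : Y × X | p.1 ≠ G p.2} :=
    (measurableSet_eq_fun measurable_fst (hG.comp measurable_snd)).compl
  refine ⟨condDistrib id G P, inferInstance, ?_, fun B hB ↦ ?_⟩
  -- The joint law of `(G x, x)` lives on the graph of `G`, so almost every fibre measure lives on
  -- its level set.
  · have h0 : ((P.map G) ⊗ₘ condDistrib id G P) {p : Y × X | p.1 ≠ G p.2} = 0 := by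
      rw [hc, Measure.map_apply (hG.prodMk measurable_id) hS]
      simp
    rw [Measure.compProd_apply hS, lintegral_eq_zero_iff (Kernel.measurable_kernel_prodMk_left hS)]
      at h0
    filter_upwards [h0] with y hy
    refine Eq.trans (congrArg _ ?_) hy
    ext x
    simp [eq_comm]
  · have h1 := congrArg (fun μ ↦ μ (Set.univ ×ˢ B)) hc
    beta_reduce at h1
    rw [Measure.compProd_apply (MeasurableSet.univ.prod hB),
      Measure.map_apply (hG.prodMk measurable_id) (MeasurableSet.univ.prod hB)] at h1
    have hpre : (fun x ↦ (G x, id x)) ⁻¹' Set.univ ×ˢ B = B := by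
      ext x
      simp
    rw [hpre] at h1
    simpa using h1.symm

/-- Concentration allows `y` to be replaced by `G x` under `κ y`. The joint law is thus independent
of the version, which yields uniqueness. -/
lemma IsConditional.compProd_eq {G : X → Y} (hG : Measurable G) {P : Measure X}
    [IsFiniteMeasure P] {κ : Kernel Y X} (h : IsConditional G P κ) :
    (P.map G) ⊗ₘ κ = P.map fun x ↦ (G x, x) := by
  have : IsMarkovKernel κ := ⟨h.probability⟩
  ext S hS
  have hm : Measurable fun x ↦ (G x, x) := hG.prodMk measurable_id
  rw [Measure.compProd_apply hS, Measure.map_apply hm hS, h.disintegrates _ (hm hS)]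
  refine lintegral_congr_ae (h.concentrated.mono fun y hy ↦ measure_congr ?_)
  filter_upwards [compl_mem_ae_iff.2 hy] with x hx
  have hx' : G x = y := by simpa using hx
  exact propext (by simp [← hx'] : (y, x) ∈ S ↔ (G x, x) ∈ S)

lemma IsConditional.ae_eq [MeasurableSpace.CountablyGenerated X] {G : X → Y} (hG : Measurable G)
    {P : Measure X} [IsFiniteMeasure P] {κ η : Kernel Y X} (hκ : IsConditional G P κ)
    (hη : IsConditional G P η) : ∀ᵐ y ∂(P.map G), κ y = η y := by
  have : IsMarkovKernel κ := ⟨hκ.probability⟩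
  have : IsMarkovKernel η := ⟨hη.probability⟩
  exact Kernel.ae_eq_of_compProd_eq ((hκ.compProd_eq hG).trans (hη.compProd_eq hG).symm)

/-- Conditional distributions do not change when the measure is multiplied by a function of `G`. -/
lemma IsConditional.withDensity_comp {G : X → Y} (hG : Measurable G) {P : Measure X}
    [IsFiniteMeasure P] {κ : Kernel Y X} (h : IsConditional G P κ) {g : Y → ℝ≥0∞}
    (hg : Measurable g) : IsConditional G (P.withDensity fun x ↦ g (G x)) κ := by
  have : IsMarkovKernel κ := ⟨h.probability⟩
  have hmap : (P.withDensity fun x ↦ g (G x)).map G = (P.map G).withDensity g := by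
    ext s hs
    rw [Measure.map_apply hG hs, withDensity_apply _ (hG hs), withDensity_apply _ hs,
      setLIntegral_map hs hg hG]
  refine ⟨h.probability, ?_, fun B hB ↦ ?_⟩
  · rw [hmap]
    exact (withDensity_absolutelyContinuous _ _).ae_le h.concentrated
  · have hm : Measurable fun x ↦ (G x, x) := hG.prodMk measurable_id
    have hk : Measurable fun p : Y × X ↦ g p.1 * B.indicator 1 p.2 :=
      (hg.comp measurable_fst).mul ((measurable_one.indicator hB).comp measurable_snd)
    rw [hmap, lintegral_withDensity_eq_lintegral_mul _ hg (κ.measurable_coe hB),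
      withDensity_apply _ hB, ← lintegral_indicator hB]
    calc ∫⁻ x, B.indicator (fun x ↦ g (G x)) x ∂P
        = ∫⁻ p, g p.1 * B.indicator 1 p.2 ∂(P.map fun x ↦ (G x, x)) := by
          rw [lintegral_map hk hm]
          refine lintegral_congr fun x ↦ ?_
          by_cases hx : x ∈ B <;> simp [hx]
      _ = ∫⁻ y, g y * κ y B ∂(P.map G) := by
          rw [← h.compProd_eq hG, Measure.lintegral_compProd hk]
          refine lintegral_congr fun y ↦ ?_
          dsimp only
          rw [lintegral_const_mul _ (measurable_one.indicator hB), lintegral_indicator_one hB]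

end Conditional

/-! ### The delta integral by differentiation of measures -/

section DeltaIntegral

variable {m n : ℕ} {Θ : Set (EuclideanSpace ℝ (Fin m))}

/-- Besicovitch differentiation is applied to Lebesgue measure relative to the image measure, not
conversely. The limit therefore exists almost everywhere for the image measure even on its singular
part, where the derivative is 0 and its inverse is `∞`. -/
lemma ae_isDeltaIntegralAt [IsFiniteMeasure (lebesgueOn Θ)] {G : Θ → EuclideanSpace ℝ (Fin n)}
    (hG : Measurable G) : ∀ᵐ y ∂((lebesgueOn Θ).map G),
      IsDeltaIntegralAt G y
        ((volume : Measure (EuclideanSpace ℝ (Fin n))).rnDeriv ((lebesgueOn Θ).map G) y)⁻¹ := by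
  filter_upwards [Besicovitch.ae_tendsto_rnDeriv
    (volume : Measure (EuclideanSpace ℝ (Fin n))) ((lebesgueOn Θ).map G)] with y hy
  refine (tendsto_congr' ?_).1 (((continuous_inv (G := ℝ≥0∞)).tendsto _).comp hy)
  filter_upwards [self_mem_nhdsWithin] with ε (hε : 0 < ε)
  have hset : {x' : Θ | ‖y - G x'‖ ≤ ε} = G ⁻¹' Metric.closedBall y ε := by
    ext x'
    simp [dist_eq_norm, norm_sub_rev]
  rw [Function.comp_apply, hset, ← Measure.map_apply hG measurableSet_closedBall,
    ← Measure.addHaar_closedBall_center volume y ε,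
    ENNReal.inv_div (Or.inr measure_closedBall_lt_top.ne)
      (Or.inr (Metric.measure_closedBall_pos volume y hε).ne')]

end DeltaIntegral

end EntropyInversion

/-! ### The theorem -/

open EntropyInversion in
theorem theorem3p1 {m n : ℕ} (Θ : Set (EuclideanSpace ℝ (Fin m))) (hΘ : IsCompact Θ)
    (G : Θ → EuclideanSpace ℝ (Fin n)) (hG : Measurable G)
    -- the data distribution, absolutely continuous with density `r`
    (ρy : Measure (EuclideanSpace ℝ (Fin n))) (r : EuclideanSpace ℝ (Fin n) → ℝ≥0)
    (hr : Measurable r) (hρy : ρy = volume.withDensity (fun y => (r y : ℝ≥0∞)))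
    -- the optimizer
    (ρ : Θ → ℝ≥0) (hρ : EntropyInversion.IsEntropyMinimizer G ρy ρ) :
    -- the conditional distributions exist, those of `ρ` are uniform on the level sets
    ((∃ κ : Kernel (EuclideanSpace ℝ (Fin n)) Θ,
        EntropyInversion.IsConditional G (EntropyInversion.densityMeasure ρ) κ) ∧
      (∃ u : Kernel (EuclideanSpace ℝ (Fin n)) Θ, EntropyInversion.IsUniformOnLevelSets G u) ∧
      ∀ κ u : Kernel (EuclideanSpace ℝ (Fin n)) Θ,
        EntropyInversion.IsConditional G (EntropyInversion.densityMeasure ρ) κ →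
        EntropyInversion.IsUniformOnLevelSets G u →
        ∀ᵐ y ∂ρy, κ y = u y) ∧
    -- the explicit formula, with the Dirac delta as a limit of normalized indicators of balls
    (∀ᵐ x ∂(EntropyInversion.lebesgueOn Θ), ∃ d : ℝ≥0∞, EntropyInversion.IsDeltaIntegralAt G (G x) d ∧ d ≠ 0 ∧
      (ρ x : ℝ≥0∞) = (r (G x) : ℝ≥0∞) / d) ∧
    -- the explicit formula, with the Dirac delta as a distribution
    (∀ D : EuclideanSpace ℝ (Fin n) → ℝ≥0∞, EntropyInversion.IsDeltaDensity G D →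
      ∀ᵐ x ∂(EntropyInversion.lebesgueOn Θ), D (G x) ≠ 0 ∧ D (G x) ≠ ∞ ∧
        (ρ x : ℝ≥0∞) = (r (G x) : ℝ≥0∞) / D (G x)) := by
  have := isFiniteMeasure_lebesgueOn hΘ
  have hmass := hρ.feasible.mass_one
  have hpush := hρ.feasible.pushforward
  set ν := (lebesgueOn Θ).map G with hν
  have hνfin : IsFiniteMeasure ν := by rw [hν]; infer_instance
  have hP1 : densityMeasure ρ Set.univ = 1 := by
    rw [densityMeasure, withDensity_apply _ MeasurableSet.univ, setLIntegral_univ, hmass]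
  have hP : IsProbabilityMeasure (densityMeasure ρ) := ⟨hP1⟩
  have hρyP : IsFiniteMeasure ρy := by rw [← hpush]; infer_instance
  have hac : ρy ≪ ν := hpush ▸ (withDensity_absolutelyContinuous _ _).map hG
  have hdec : ρy.HaveLebesgueDecomposition ν :=
    Measure.haveLebesgueDecomposition_of_sigmaFinite ρy ν
  set g : EuclideanSpace ℝ (Fin n) → ℝ≥0 := fun y ↦ (ρy.rnDeriv ν y).toNNReal
  have hg : Measurable g := (Measure.measurable_rnDeriv _ _).ennreal_toNNReal
  have hgν : ∀ᵐ y ∂ν, (g y : ℝ≥0∞) = ρy.rnDeriv ν y :=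
    (Measure.rnDeriv_lt_top ρy ν).mono fun y hy ↦ ENNReal.coe_toNNReal hy.ne
  have hρyg : ρy = ν.withDensity fun y ↦ (g y : ℝ≥0∞) := by
    rw [withDensity_congr_ae hgν, Measure.withDensity_rnDeriv_eq _ _ hac]
  have hopt : ∀ᵐ x ∂(lebesgueOn Θ), ρ x = g (G x) := hρ.ae_eq_comp hΘ hG hg hρyg
  refine ⟨?_, ?_, ?_⟩
  · have hstd : StandardBorelSpace Θ := hΘ.measurableSet.standardBorel
    have hl0 : lebesgueOn Θ Set.univ ≠ 0 := by
      intro h0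
      rw [Measure.measure_univ_eq_zero.1 h0] at hmass
      simp at hmass
    have hne : Nonempty Θ := by
      by_contra hemp
      rw [not_nonempty_iff] at hemp
      exact hl0 (by simp [Set.univ_eq_empty_iff.2 hemp])
    have hltop : lebesgueOn Θ Set.univ ≠ ∞ := measure_ne_top _ _
    have hU : IsFiniteMeasure (uniformDistribution Θ) :=
      Measure.smul_finite _ (ENNReal.inv_ne_top.2 hl0)
    refine ⟨exists_isConditional hG _, exists_isConditional hG _, fun κ u hκ hu ↦ ?_⟩
    -- The factor `lebesgueOn Θ Set.univ` undoes the normalization of the uniform distribution.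
    have hden : densityMeasure ρ = (uniformDistribution Θ).withDensity
        fun x ↦ lebesgueOn Θ Set.univ * (g (G x) : ℝ≥0∞) := by
      rw [densityMeasure, uniformDistribution, withDensity_smul_measure,
        ← withDensity_smul _ (by fun_prop)]
      refine withDensity_congr_ae (hopt.mono fun x hx ↦ ?_)
      simp only [Pi.smul_apply, smul_eq_mul, hx]
      rw [← mul_assoc, ENNReal.inv_mul_cancel hl0 hltop, one_mul]
    have hu' : IsConditional G (densityMeasure ρ) u := hden ▸ IsConditional.withDensity_comp hG hu
      (g := fun y ↦ lebesgueOn Θ Set.univ * (g y : ℝ≥0∞)) (by fun_prop)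
    rw [← hpush]
    exact hκ.ae_eq hG hu'
  · have hrn : ∀ᵐ y ∂ν, ρy.rnDeriv ν y =
        (r y : ℝ≥0∞) * (volume : Measure (EuclideanSpace ℝ (Fin n))).rnDeriv ν y := by
      rw [hρy]
      exact Measure.rnDeriv_withDensity_left (by fun_prop) (by simp)
    have hall : ∀ᵐ y ∂ν, ∃ d : ℝ≥0∞, IsDeltaIntegralAt G y d ∧ d ≠ 0 ∧
        (g y : ℝ≥0∞) = (r y : ℝ≥0∞) / d := by
      filter_upwards [hrn, hgν, ae_isDeltaIntegralAt hG,
        Measure.rnDeriv_lt_top (volume : Measure (EuclideanSpace ℝ (Fin n))) ν]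
        with y h1 h2 h3 h4
      -- Here `d` is the inverse of the derivative of volume by `ν`; finiteness of that derivative
      -- gives `d ≠ 0`.
      exact ⟨_, h3, ENNReal.inv_ne_zero.2 h4.ne, by rw [h2, h1, div_eq_mul_inv, inv_inv]⟩
    filter_upwards [hopt, ae_of_ae_map hG.aemeasurable hall] with x hx hd
    rwa [hx]
  · rintro D ⟨hDm, hD⟩
    rw [← hν] at hD
    have hDtop : ∀ᵐ y ∂(volume : Measure (EuclideanSpace ℝ (Fin n))), D y < ∞ := by
      refine ae_lt_top hDm ?_
      rw [← setLIntegral_univ, ← withDensity_apply _ MeasurableSet.univ, ← hD]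
      exact measure_ne_top _ _
    -- Both sides are Lebesgue densities of `ρy`.
    have hDg : ∀ᵐ y ∂(volume : Measure (EuclideanSpace ℝ (Fin n))), D y * g y = r y := by
      have h1 : (volume : Measure (EuclideanSpace ℝ (Fin n))).withDensity
          (D * fun y ↦ (g y : ℝ≥0∞)) = volume.withDensity fun y ↦ (r y : ℝ≥0∞) := by
        rw [withDensity_mul _ hDm (by fun_prop), ← hD, ← hρyg, hρy]
      exact (withDensity_eq_iff_of_sigmaFinite (by fun_prop) (by fun_prop)).1 h1
    have hνvol : ν ≪ volume := hD ▸ withDensity_absolutelyContinuous _ _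
    have hD0 : ∀ᵐ y ∂ν, D y ≠ 0 := by
      rw [hD, ae_withDensity_iff hDm]
      exact ae_of_all _ fun y hy ↦ hy
    have hall : ∀ᵐ y ∂ν, D y ≠ 0 ∧ D y ≠ ∞ ∧ (g y : ℝ≥0∞) = (r y : ℝ≥0∞) / D y := by
      filter_upwards [hD0, hνvol.ae_le hDtop, hνvol.ae_le hDg] with y h0 htop h
      exact ⟨h0, htop.ne, by rw [← h, mul_comm, ENNReal.mul_div_cancel_right h0 htop.ne]⟩
    filter_upwards [hopt, ae_of_ae_map hG.aemeasurable hall] with x hx hd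
    rwa [hx]
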